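/- Let $\varphi$ denote Euler's totient function and, for positive integers $n_1,n_2$, put $$f(n_1,n_2)=\frac{\varphi(n_1)\,\varphi(n_2)}{\operatorname{lcm}(n_1,n_2)}.$$ Then the infinite product below, over all prime numbers $p$, converges unconditionally, and $$\lim_{x\to\infty}\frac{1}{x^2\log x}\sum_{n_1,n_2\le x} f(n_1,n_2)=\prod_{p}\Bigl(1-\frac1p\Bigr)^3\Bigl(1+\frac3p+\frac1{p^2}\Bigr),$$ where $x$ tends to infinity through the real numbers and the sum is over all pairs of positive integers $n_1,n_2\le x$. -/

import Mathlib

/-- The two-variable arithmetic function `f(n₁, n₂) = φ(n₁) φ(n₂) / lcm(n₁, n₂)`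
(for positive integers `n₁, n₂`), where `φ` is Euler's totient function. -/
noncomputable def totientLcm (n₁ n₂ : ℕ) : ℝ :=
  ((Nat.totient n₁ : ℝ) * (Nat.totient n₂ : ℝ)) / (Nat.lcm n₁ n₂ : ℝ)

/-! Write r(n) = φ(n)/n. Then f(a,b) = r(a) r(b) gcd(a,b), and expanding gcd(a,b) as the sum of φ(d)
over common divisors d turns the double sum into Σ_d φ(d) (Σ_{m ≤ x/d} r(dm))² (`sum_totientLcm`).
For fixed d, r(dm)/r(d) is a divisor sum over m of small weights, so the inner sum is r(d) C(d) x/d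
+ O(√(x/d)) uniformly in d, where C(d) is the product of 1 - 1/p² over p ∤ d
(`abs_sum_totientRatio_sub_le`). After squaring, the errors total O(x²), and the main term is x² Σ_d
r(d)³ C(d)²/d. Here r(d)³ C(d)² is C(1)² times a divisor sum of squarefree-supported weights of size
O(1/p) at p. Its logarithmic mean is an absolutely convergent series
(`tendsto_sum_sum_divisors_div_log`), whose Euler product gives the constant
(`hasProd_leadingConst`). -/

/-! ### Squarefree-supported multiplicative functions and their Euler products -/

/-- The function supported on squarefree integers with value `∏ p ∣ n, u p` there. -/
noncomputable def squarefreeProd (u : ℕ → ℝ) (n : ℕ) : ℝ :=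
  if Squarefree n then ∏ p ∈ n.primeFactors, u p else 0

@[simp] lemma squarefreeProd_zero (u : ℕ → ℝ) : squarefreeProd u 0 = 0 := by
  simp [squarefreeProd]

@[simp] lemma squarefreeProd_one (u : ℕ → ℝ) : squarefreeProd u 1 = 1 := by
  simp [squarefreeProd]

lemma squarefreeProd_mul (u : ℕ → ℝ) {m n : ℕ} (h : m.Coprime n) :
    squarefreeProd u (m * n) = squarefreeProd u m * squarefreeProd u n := by
  unfold squarefreeProd
  simp only [Nat.squarefree_mul h, h.primeFactors_mul,
    Finset.prod_union h.disjoint_primeFactors]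
  by_cases hm : Squarefree m <;> by_cases hn : Squarefree n <;> simp [hm, hn]

/-- The expansion of `∏ p ∣ n, (1 + u p)` as a sum over the divisors of `n`. -/
lemma prod_primeFactors_one_add (u : ℕ → ℝ) {n : ℕ} (hn : n ≠ 0) :
    ∏ p ∈ n.primeFactors, (1 + u p) = ∑ e ∈ n.divisors, squarefreeProd u e := by
  rw [Finset.prod_one_add]
  unfold squarefreeProd
  rw [← Finset.sum_filter]
  refine Finset.sum_bij' (fun S _ => ∏ p ∈ S, p) (fun e _ => e.primeFactors) ?_ ?_ ?_ ?_ ?_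
  · intro S hS
    have hS' : S ⊆ n.primeFactors := Finset.mem_powerset.1 hS
    have hp : ∀ p ∈ S, p.Prime := fun p hp => Nat.prime_of_mem_primeFactors (hS' hp)
    simp only [Finset.mem_filter, Nat.mem_divisors]
    refine ⟨⟨(Finset.prod_dvd_prod_of_subset _ _ _ hS').trans (Nat.prod_primeFactors_dvd n), hn⟩,
      Finset.squarefree_prod_of_pairwise_isCoprime ?_ fun p h => (hp p h).squarefree⟩
    intro p h q h' hpq
    exact Nat.coprime_iff_isRelPrime.1 ((Nat.coprime_primes (hp p h) (hp q h')).2 hpq)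
  · intro e he
    simp only [Finset.mem_filter, Nat.mem_divisors] at he
    exact Finset.mem_powerset.2 (Nat.primeFactors_mono he.1.1 hn)
  · intro S hS
    exact Nat.primeFactors_prod fun p hp =>
      Nat.prime_of_mem_primeFactors (Finset.mem_powerset.1 hS hp)
  · intro e he
    exact Nat.prod_primeFactors_of_squarefree (Finset.mem_filter.1 he).2
  · intro S hS
    rw [Nat.primeFactors_prod fun p hp =>
      Nat.prime_of_mem_primeFactors (Finset.mem_powerset.1 hS hp)]

/-- The Euler product of `∑ n, squarefreeProd u n / n`. -/
lemma hasProd_squarefreeProd (u : ℕ → ℝ) (hu : Summable fun n => |squarefreeProd u n / n|) :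
    HasProd (fun p : Nat.Primes => 1 + u p / ((p : ℕ) : ℝ)) (∑' n, squarefreeProd u n / n) := by
  have key := EulerProduct.eulerProduct_hasProd (f := fun n : ℕ => squarefreeProd u n / n)
    (by simp) (fun {m n} h => by
      simp only [squarefreeProd_mul u h, Nat.cast_mul, mul_div_mul_comm]) hu (by simp)
  have hlocal : ∀ p : Nat.Primes, ∑' e : ℕ, squarefreeProd u ((p : ℕ) ^ e) /
      (((p : ℕ) ^ e : ℕ) : ℝ) = 1 + u p / ((p : ℕ) : ℝ) := by
    intro p
    rw [tsum_eq_sum (s := Finset.range 2)]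
    · simp [Finset.sum_range_succ, squarefreeProd, p.2.squarefree, p.2.primeFactors]
    · intro e he
      have he' : 1 < e := by simpa using he
      have : ¬ Squarefree ((p : ℕ) ^ e) := fun h =>
        absurd ((Nat.squarefree_pow_iff p.2.ne_one (by omega)).1 h).2 (by omega)
      simp [squarefreeProd, this]
  simpa only [hlocal] using key

lemma abs_squarefreeProd_le_inv (u : ℕ → ℝ) (hu : ∀ p : ℕ, p.Prime → |u p| ≤ 1 / p) (n : ℕ) :
    |squarefreeProd u n| ≤ 1 / n := by
  unfold squarefreeProd
  split_ifs with h
  · rw [Finset.abs_prod]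
    calc ∏ p ∈ n.primeFactors, |u p| ≤ ∏ p ∈ n.primeFactors, (1 / p : ℝ) :=
          Finset.prod_le_prod (fun _ _ => abs_nonneg _)
            fun p hp => hu p (Nat.prime_of_mem_primeFactors hp)
      _ = 1 / n := by
          rw [Finset.prod_div_distrib, Finset.prod_const_one, ← Nat.cast_prod,
            Nat.prod_primeFactors_of_squarefree h]
  · simp

/-- For p ≥ 9 one has 3/p ≤ 1/√p; each smaller prime costs a factor of at most 3, and there are
crudely at most 9 of them. -/
lemma abs_squarefreeProd_le_sqrt (u : ℕ → ℝ) (hu : ∀ p : ℕ, p.Prime → |u p| ≤ 3 / p) (n : ℕ) :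
    |squarefreeProd u n| ≤ 3 ^ 9 * (1 / √n) := by
  unfold squarefreeProd
  split_ifs with h
  · rw [Finset.abs_prod]
    have hstep : ∀ p ∈ n.primeFactors,
        |u p| ≤ (if p < 9 then 3 else 1) * (1 / √p) := by
      intro p hp
      have hp' := Nat.prime_of_mem_primeFactors hp
      have hp1 : (1 : ℝ) ≤ p := by exact_mod_cast hp'.one_lt.le
      have hs : 1 ≤ √(p : ℝ) := Real.one_le_sqrt.2 hp1
      refine (hu p hp').trans ?_
      have hpp : (3 : ℝ) / p = 3 / √p * (1 / √p) := by
        rw [div_mul_div_comm, Real.mul_self_sqrt (by positivity), mul_one]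
      rw [hpp]
      gcongr
      split_ifs with h9
      · exact div_le_self (by norm_num) hs
      · rw [div_le_one (by positivity)]
        apply Real.le_sqrt_of_sq_le
        have : (9 : ℝ) ≤ p := by exact_mod_cast not_lt.1 h9
        linarith
    calc ∏ p ∈ n.primeFactors, |u p|
        ≤ ∏ p ∈ n.primeFactors, ((if p < 9 then 3 else 1) * (1 / √p) : ℝ) :=
          Finset.prod_le_prod (fun _ _ => abs_nonneg _) hstep
      _ = 3 ^ (n.primeFactors.filter (· < 9)).card * (1 / √n) := by
          rw [Finset.prod_mul_distrib, Finset.prod_ite, Finset.prod_const, Finset.prod_const_one,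
            mul_one, Finset.prod_div_distrib, Finset.prod_const_one]
          congr 2
          rw [← Real.sqrt_prod _ fun i _ => by positivity, ← Nat.cast_prod,
            Nat.prod_primeFactors_of_squarefree h]
      _ ≤ 3 ^ 9 * (1 / √n) := by
          gcongr
          · norm_num
          · refine (Finset.card_le_card (t := Finset.range 9) ?_).trans (by simp)
            intro p hp
            simpa using (Finset.mem_filter.1 hp).2
  · simp

lemma summable_abs_squarefreeProd_div (u : ℕ → ℝ) (hu : ∀ p : ℕ, p.Prime → |u p| ≤ 3 / p) :
    Summable fun n => |squarefreeProd u n / n| := by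
  have hs : Summable fun n : ℕ => (3 : ℝ) ^ 9 * (1 / (n : ℝ) ^ (3 / 2 : ℝ)) :=
    (Real.summable_one_div_nat_rpow.2 (by norm_num)).mul_left _
  refine Summable.of_nonneg_of_le (fun _ => abs_nonneg _) (fun n => ?_) hs
  rcases Nat.eq_zero_or_pos n with rfl | hn
  · simp
  have hn' : (0 : ℝ) < n := by exact_mod_cast hn
  rw [abs_div, Nat.abs_cast, show (3 / 2 : ℝ) = 1 / 2 + 1 by norm_num, Real.rpow_add hn',
    ← Real.sqrt_eq_rpow, Real.rpow_one, ← div_div, ← mul_div_assoc]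
  gcongr
  exact abs_squarefreeProd_le_sqrt u hu n

/-! ### Rearranging divisor sums -/

/-- Exchange of summation over the pairs `(n, e)` with `e ∣ n ≤ N`. -/
lemma sum_Icc_sum_divisors (F : ℕ → ℕ → ℝ) (N : ℕ) :
    ∑ n ∈ Finset.Icc 1 N, ∑ e ∈ n.divisors, F e (n / e) =
      ∑ e ∈ Finset.Icc 1 N, ∑ m ∈ Finset.Icc 1 (N / e), F e m := by
  rw [Finset.sum_sigma', Finset.sum_sigma']
  refine Finset.sum_bij' (fun x _ => ⟨x.2, x.1 / x.2⟩) (fun y _ => ⟨y.1 * y.2, y.1⟩) ?_ ?_ ?_ ?_ ?_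
  · rintro ⟨n, e⟩ h
    simp only [Finset.mem_sigma, Finset.mem_Icc, Nat.mem_divisors] at h ⊢
    have he := Nat.pos_of_dvd_of_pos h.2.1 (by omega)
    have := Nat.le_of_dvd (by omega) h.2.1
    exact ⟨⟨he, by omega⟩, Nat.div_pos this he, Nat.div_le_div_right h.1.2⟩
  · rintro ⟨e, m⟩ h
    simp only [Finset.mem_sigma, Finset.mem_Icc, Nat.mem_divisors] at h ⊢
    have h1 : 0 < e * m := Nat.mul_pos (by omega) (by omega)
    refine ⟨⟨h1, ?_⟩, dvd_mul_right _ _, h1.ne'⟩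
    rw [mul_comm]
    exact (Nat.le_div_iff_mul_le (by omega)).1 h.2.2
  · rintro ⟨n, e⟩ h
    simp only [Finset.mem_sigma, Finset.mem_Icc, Nat.mem_divisors] at h
    simp [Nat.mul_div_cancel' h.2.1]
  · rintro ⟨e, m⟩ h
    simp only [Finset.mem_sigma, Finset.mem_Icc] at h
    simp [Nat.mul_div_cancel_left m (show 0 < e by omega)]
  · rintro ⟨n, e⟩ h
    rfl

lemma sum_Icc_filter_dvd (g : ℕ → ℝ) (N : ℕ) {d : ℕ} (hd : 0 < d) :
    ∑ n ∈ Finset.Icc 1 N with d ∣ n, g n = ∑ m ∈ Finset.Icc 1 (N / d), g (d * m) := by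
  symm
  refine Finset.sum_bij' (fun m _ => d * m) (fun n _ => n / d) ?_ ?_ ?_ ?_ ?_
  · intro m h
    simp only [Finset.mem_filter, Finset.mem_Icc] at h ⊢
    refine ⟨⟨Nat.mul_pos hd (by omega), ?_⟩, dvd_mul_right _ _⟩
    rw [mul_comm]
    exact (Nat.le_div_iff_mul_le hd).1 h.2
  · intro n h
    simp only [Finset.mem_filter, Finset.mem_Icc] at h ⊢
    exact ⟨Nat.div_pos (Nat.le_of_dvd (by omega) h.2) hd, Nat.div_le_div_right h.1.2⟩
  · intro m h
    exact Nat.mul_div_cancel_left m hd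
  · intro n h
    exact Nat.mul_div_cancel' (Finset.mem_filter.1 h).2
  · intro m h
    rfl

/-! ### Decoupling the two variables through the gcd -/

/-- The density `φ(n) / n`, written as a product over the primes dividing `n`. -/
noncomputable def totientRatio (n : ℕ) : ℝ := ∏ p ∈ n.primeFactors, (1 - 1 / (p : ℝ))

lemma totient_eq_mul_totientRatio (n : ℕ) : (n.totient : ℝ) = n * totientRatio n := by
  have h := congrArg (Rat.cast : ℚ → ℝ) (Nat.totient_eq_mul_prod_factors n)
  push_cast at h
  simpa [totientRatio] using h

lemma one_sub_one_div_prime_mem {p : ℕ} (hp : p.Prime) :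
    0 ≤ 1 - 1 / (p : ℝ) ∧ 1 - 1 / (p : ℝ) ≤ 1 := by
  have h : (1 : ℝ) ≤ p := by exact_mod_cast hp.one_lt.le
  refine ⟨sub_nonneg.2 ((div_le_one (by positivity)).2 h), ?_⟩
  have : 0 ≤ 1 / (p : ℝ) := by positivity
  linarith

lemma totientRatio_nonneg (n : ℕ) : 0 ≤ totientRatio n :=
  Finset.prod_nonneg fun _ hp => (one_sub_one_div_prime_mem (Nat.prime_of_mem_primeFactors hp)).1

lemma totientRatio_le_one (n : ℕ) : totientRatio n ≤ 1 :=
  Finset.prod_le_one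
    (fun _ hp => (one_sub_one_div_prime_mem (Nat.prime_of_mem_primeFactors hp)).1)
    fun _ hp => (one_sub_one_div_prime_mem (Nat.prime_of_mem_primeFactors hp)).2

lemma totientLcm_eq {a b : ℕ} (ha : a ≠ 0) (hb : b ≠ 0) :
    totientLcm a b = totientRatio a * totientRatio b * (a.gcd b : ℝ) := by
  have h : (a.gcd b : ℝ) * a.lcm b = a * b := by exact_mod_cast Nat.gcd_mul_lcm a b
  have hl : (a.lcm b : ℝ) ≠ 0 := by exact_mod_cast Nat.lcm_ne_zero ha hb
  rw [totientLcm, div_eq_iff hl, totient_eq_mul_totientRatio a, totient_eq_mul_totientRatio b]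
  linear_combination (-(totientRatio a * totientRatio b)) * h

lemma cast_gcd_eq_sum {a b N : ℕ} (ha : a ∈ Finset.Icc 1 N) :
    (a.gcd b : ℝ) = ∑ d ∈ Finset.Icc 1 N, if d ∣ a ∧ d ∣ b then (d.totient : ℝ) else 0 := by
  rw [Finset.mem_Icc] at ha
  have h : (a.gcd b : ℝ) = ∑ d ∈ (a.gcd b).divisors, (d.totient : ℝ) := by
    exact_mod_cast (Nat.sum_totient (a.gcd b)).symm
  rw [h, ← Finset.sum_filter]
  congr 1
  ext d
  simp only [Nat.mem_divisors, Finset.mem_filter, Finset.mem_Icc, Nat.dvd_gcd_iff]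
  constructor
  · rintro ⟨h1, -⟩
    exact ⟨⟨Nat.pos_of_dvd_of_pos h1.1 (by omega),
      (Nat.le_of_dvd (by omega) h1.1).trans ha.2⟩, h1⟩
  · rintro ⟨-, h1⟩
    exact ⟨h1, (Nat.gcd_pos_of_pos_left _ (by omega)).ne'⟩

lemma sum_totientLcm (N : ℕ) :
    ∑ a ∈ Finset.Icc 1 N, ∑ b ∈ Finset.Icc 1 N, totientLcm a b =
      ∑ d ∈ Finset.Icc 1 N, (d.totient : ℝ) *
        (∑ m ∈ Finset.Icc 1 (N / d), totientRatio (d * m)) ^ 2 := by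
  have h1 : ∀ a ∈ Finset.Icc 1 N, ∀ b ∈ Finset.Icc 1 N, totientLcm a b =
      ∑ d ∈ Finset.Icc 1 N, (d.totient : ℝ) *
        ((if d ∣ a then totientRatio a else 0) * (if d ∣ b then totientRatio b else 0)) := by
    intro a ha b hb
    rw [totientLcm_eq (by simp at ha; omega) (by simp at hb; omega), cast_gcd_eq_sum ha,
      Finset.mul_sum]
    refine Finset.sum_congr rfl fun d _ => ?_
    by_cases h1 : d ∣ a <;> by_cases h2 : d ∣ b <;> simp [h1, h2]
    ring
  rw [Finset.sum_congr rfl fun a ha => Finset.sum_congr rfl (h1 a ha),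
    Finset.sum_congr rfl fun a _ => Finset.sum_comm, Finset.sum_comm]
  refine Finset.sum_congr rfl fun d hd => ?_
  rw [← sum_Icc_filter_dvd _ _ (show 0 < d by simp at hd; omega), Finset.sum_filter, sq,
    Finset.sum_mul_sum, Finset.mul_sum]
  exact Finset.sum_congr rfl fun a _ => by rw [Finset.mul_sum]

/-! ### Mean value of the totient ratio over multiples of d -/

/-- The local weights of `totientRatio (d * m) / totientRatio d` as a function of `m`. -/
noncomputable def coprimeWeight (d p : ℕ) : ℝ := if p ∣ d then 0 else -(1 / (p : ℝ))

lemma abs_coprimeWeight_le (d p : ℕ) : |coprimeWeight d p| ≤ 1 / p := by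
  unfold coprimeWeight
  split_ifs
  · simp
  · rw [abs_neg, abs_of_nonneg (by positivity)]

/-- Only the primes dividing m but not d contribute new factors. -/
lemma totientRatio_mul {d m : ℕ} (hd : d ≠ 0) (hm : m ≠ 0) :
    totientRatio (d * m) =
      totientRatio d * ∑ e ∈ m.divisors, squarefreeProd (coprimeWeight d) e := by
  rw [← prod_primeFactors_one_add _ hm, totientRatio, totientRatio, Nat.primeFactors_mul hd hm,
    ← Finset.union_sdiff_self_eq_union, Finset.prod_union Finset.disjoint_sdiff]
  congr 1
  rw [Finset.sdiff_eq_filter, Finset.prod_filter]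
  refine Finset.prod_congr rfl fun p hp => ?_
  have hp' := Nat.prime_of_mem_primeFactors hp
  by_cases h : p ∣ d <;> simp [coprimeWeight, h, hp', hd, sub_eq_add_neg]

/-- The square root, unlike the bound 1, stays valid and small for y < 1. It can thus be applied
with y/n for every n, which absorbs the tail of the series. -/
lemma abs_floor_sub_le_sqrt {y : ℝ} (hy : 0 ≤ y) : |(⌊y⌋₊ : ℝ) - y| ≤ √y := by
  have h1 := Nat.floor_le hy
  have h2 := Nat.lt_floor_add_one y
  rw [abs_sub_comm, abs_of_nonneg (by linarith)]
  rcases lt_or_ge y 1 with h | h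
  · rw [Nat.floor_eq_zero.2 h, Nat.cast_zero, sub_zero]
    apply Real.le_sqrt_of_sq_le
    nlinarith
  · linarith [Real.one_le_sqrt.2 h]

/-- The constant in the square-root error terms. -/
noncomputable def sqrtErrorConst : ℝ := ∑' n : ℕ, 1 / (n : ℝ) ^ (3 / 2 : ℝ)

lemma summable_sqrtErrorConst : Summable fun n : ℕ => 1 / (n : ℝ) ^ (3 / 2 : ℝ) :=
  Real.summable_one_div_nat_rpow.2 (by norm_num)

lemma one_div_rpow_three_halves (n : ℕ) :
    1 / (n : ℝ) ^ (3 / 2 : ℝ) = 1 / n * (1 / √n) := by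
  rcases Nat.eq_zero_or_pos n with rfl | hn
  · simp
  have hn' : (0 : ℝ) < n := by exact_mod_cast hn
  rw [show (3 / 2 : ℝ) = 1 + 1 / 2 by norm_num, Real.rpow_add hn', ← Real.sqrt_eq_rpow,
    Real.rpow_one, one_div_mul_one_div]

lemma abs_div_le_of_abs_le_inv {w : ℕ → ℝ} (hw : ∀ n, |w n| ≤ 1 / n) (n : ℕ) :
    |w n / n| ≤ 1 / (n : ℝ) ^ (3 / 2 : ℝ) := by
  rw [one_div_rpow_three_halves]
  rcases Nat.eq_zero_or_pos n with rfl | hn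
  · simp
  have hn' : (1 : ℝ) ≤ n := by exact_mod_cast hn
  rw [abs_div, Nat.abs_cast, div_eq_mul_one_div]
  gcongr
  · exact hw n
  · rw [Real.sqrt_le_left (by linarith)]
    nlinarith

lemma summable_div_of_abs_le_inv {w : ℕ → ℝ} (hw : ∀ n, |w n| ≤ 1 / n) :
    Summable fun n : ℕ => w n / n :=
  Summable.of_norm_bounded summable_sqrtErrorConst (abs_div_le_of_abs_le_inv hw)

lemma abs_tsum_div_le {w : ℕ → ℝ} (hw : ∀ n, |w n| ≤ 1 / n) :
    |∑' n, w n / n| ≤ sqrtErrorConst := by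
  rw [sqrtErrorConst, ← Real.norm_eq_abs]
  exact tsum_of_norm_bounded summable_sqrtErrorConst.hasSum (abs_div_le_of_abs_le_inv hw)

lemma sum_Icc_floor_sum_divisors (w : ℕ → ℝ) (y : ℝ) :
    ∑ m ∈ Finset.Icc 1 ⌊y⌋₊, ∑ e ∈ m.divisors, w e =
      ∑ e ∈ Finset.Icc 1 ⌊y⌋₊, w e * (⌊y / e⌋₊ : ℝ) := by
  rw [sum_Icc_sum_divisors (fun e _ => w e)]
  refine Finset.sum_congr rfl fun e _ => ?_
  rw [Finset.sum_const, Nat.card_Icc, nsmul_eq_mul, Nat.floor_div_natCast, mul_comm]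
  simp

/-- The mean value of `1 * w` for a small weight `w`, with a square-root error term. -/
lemma abs_sum_sum_divisors_sub_le {w : ℕ → ℝ} (hw : ∀ n, |w n| ≤ 1 / n) {y : ℝ} (hy : 0 ≤ y) :
    |∑ m ∈ Finset.Icc 1 ⌊y⌋₊, ∑ e ∈ m.divisors, w e - y * ∑' n, w n / n| ≤
      sqrtErrorConst * √y := by
  -- Terms with e > y vanish, so the finite sum is a full series and can be compared with the main
  -- term termwise.
  have hsupp : ∀ e ∉ Finset.Icc 1 ⌊y⌋₊, w e * (⌊y / e⌋₊ : ℝ) = 0 := by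
    intro e he
    rcases Nat.eq_zero_or_pos e with rfl | he0
    · simp
    have : ⌊y⌋₊ < e := by
      by_contra h
      exact he (Finset.mem_Icc.2 ⟨he0, not_lt.1 h⟩)
    rw [Nat.floor_div_natCast, Nat.div_eq_of_lt this, Nat.cast_zero, mul_zero]
  rw [sum_Icc_floor_sum_divisors, ← tsum_eq_sum (L := .unconditional ℕ) hsupp, ← tsum_mul_left,
    ← (summable_of_ne_finset_zero (L := .unconditional ℕ) hsupp).tsum_sub ((summable_div_of_abs_le_inv hw).mul_left y)]
  rw [← Real.norm_eq_abs]
  refine (tsum_of_norm_bounded (summable_sqrtErrorConst.mul_right (√y)).hasSum ?_).trans_eq ?_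
  · intro n
    have h := abs_floor_sub_le_sqrt (y := y / n) (by positivity)
    rw [show w n * (⌊y / n⌋₊ : ℝ) - y * (w n / n) = w n * (⌊y / n⌋₊ - y / n) by ring,
      Real.norm_eq_abs, abs_mul, one_div_rpow_three_halves, mul_assoc]
    refine mul_le_mul (hw n) (h.trans_eq ?_) (abs_nonneg _) (by positivity)
    rw [Real.sqrt_div hy]
    ring
  · rw [tsum_mul_right, sqrtErrorConst]

/-- The constant `∏ (1 - 1 / p ^ 2)` over primes `p` not dividing `d`, as a Dirichlet series. -/
noncomputable def coprimeConst (d : ℕ) : ℝ :=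
  ∑' n : ℕ, squarefreeProd (coprimeWeight d) n / n

lemma abs_squarefreeProd_coprimeWeight_le (d n : ℕ) :
    |squarefreeProd (coprimeWeight d) n| ≤ 1 / n :=
  abs_squarefreeProd_le_inv _ (fun p _ => abs_coprimeWeight_le d p) n

lemma hasProd_coprimeConst (d : ℕ) :
    HasProd (fun p : Nat.Primes => 1 + coprimeWeight d p / ((p : ℕ) : ℝ)) (coprimeConst d) :=
  hasProd_squarefreeProd _
    (summable_div_of_abs_le_inv (abs_squarefreeProd_coprimeWeight_le d)).abs

/-- The finite product restores the Euler factors at p ∣ d; uniqueness of the infinite product then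
identifies the values. -/
lemma coprimeConst_mul_prod {d : ℕ} (hd : d ≠ 0) :
    coprimeConst d * ∏ p ∈ d.primeFactors, (1 - 1 / (p : ℝ) ^ 2) = coprimeConst 1 := by
  have h1 : HasProd (fun p : Nat.Primes => if (p : ℕ) ∣ d then 1 - 1 / ((p : ℕ) : ℝ) ^ 2 else 1)
      (∏ p ∈ d.primeFactors, (1 - 1 / (p : ℝ) ^ 2)) := by
    have h2 : ∏ p ∈ d.primeFactors, (1 - 1 / (p : ℝ) ^ 2) =
        ∏ p ∈ d.primeFactors.subtype Nat.Prime,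
          if (p : ℕ) ∣ d then 1 - 1 / ((p : ℕ) : ℝ) ^ 2 else 1 := by
      rw [← Finset.prod_subtype_of_mem (p := Nat.Prime) _
        fun p hp => Nat.prime_of_mem_primeFactors hp]
      refine Finset.prod_congr rfl fun p hp => ?_
      rw [if_pos (Nat.dvd_of_mem_primeFactors (Finset.mem_subtype.1 hp))]
    rw [h2]
    refine hasProd_prod_of_ne_finset_one fun p hp => if_neg fun h => hp ?_
    exact Finset.mem_subtype.2 (Nat.mem_primeFactors.2 ⟨p.2, h, hd⟩)
  refine ((hasProd_coprimeConst d).mul h1).unique ?_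
  convert hasProd_coprimeConst 1 using 2 with p
  have hp : ¬ (p : ℕ) ∣ 1 := p.2.one_lt.ne' ∘ Nat.dvd_one.1
  by_cases h : (p : ℕ) ∣ d
  · simp only [coprimeWeight, h, hp, if_true, if_false]
    ring
  · simp [coprimeWeight, h, p.2.ne_one]

lemma abs_coprimeConst_le (d : ℕ) : |coprimeConst d| ≤ sqrtErrorConst :=
  abs_tsum_div_le (abs_squarefreeProd_coprimeWeight_le d)

/-! ### The main-term density and the leading constant -/

/-- The local weights of the density governing the main term. -/
noncomputable def mainWeight (p : ℕ) : ℝ :=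
  (1 - 1 / (p : ℝ)) ^ 3 / (1 - 1 / (p : ℝ) ^ 2) ^ 2 - 1

lemma one_sub_inv_sq_pos {p : ℕ} (hp : p.Prime) : 0 < 1 - 1 / (p : ℝ) ^ 2 := by
  have h : (1 : ℝ) < p := by exact_mod_cast hp.one_lt
  rw [sub_pos, div_lt_one (by positivity)]
  nlinarith

lemma abs_mainWeight_le {p : ℕ} (hp : p.Prime) : |mainWeight p| ≤ 3 / p := by
  have h : (1 : ℝ) < p := by exact_mod_cast hp.one_lt
  have h0 : (p : ℝ) - 1 ≠ 0 := by linarith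
  have h2 : (p : ℝ) ^ 2 - 1 ≠ 0 := by nlinarith
  have key : mainWeight p = -((3 * p + 1) / ((p : ℝ) + 1) ^ 2) := by
    unfold mainWeight
    have h1 : 1 - 1 / (p : ℝ) ^ 2 = (1 - 1 / (p : ℝ)) * (1 + 1 / (p : ℝ)) := by ring
    have h3 : 1 - 1 / (p : ℝ) = (p - 1) / p := by field_simp
    have h4 : 1 + 1 / (p : ℝ) = (p + 1) / p := by field_simp
    rw [h1, h3, h4]
    have h5 : (p : ℝ) + 1 ≠ 0 := by positivity
    field_simp
    ring
  rw [key, abs_neg, abs_of_nonneg (by positivity), div_le_div_iff₀ (by positivity) (by positivity)]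
  nlinarith

/-- One factor `totientRatio d` comes from φ(d), the other two from the squared inner sum. -/
lemma totientRatio_pow_mul_coprimeConst {d : ℕ} (hd : d ≠ 0) :
    totientRatio d ^ 3 * coprimeConst d ^ 2 =
      coprimeConst 1 ^ 2 * ∑ e ∈ d.divisors, squarefreeProd mainWeight e := by
  rw [← prod_primeFactors_one_add _ hd, ← coprimeConst_mul_prod hd, mul_pow, mul_assoc,
    ← Finset.prod_pow, ← Finset.prod_mul_distrib, totientRatio, ← Finset.prod_pow, mul_comm]
  congr 1
  refine Finset.prod_congr rfl fun p hp => ?_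
  have h := (one_sub_inv_sq_pos (Nat.prime_of_mem_primeFactors hp)).ne'
  rw [mainWeight, add_sub_cancel, mul_div_cancel₀ _ (pow_ne_zero 2 h)]

/-- The Euler product of the leading constant. -/
lemma hasProd_leadingConst :
    HasProd (fun p : Nat.Primes =>
      (1 - 1 / ((p : ℕ) : ℝ)) ^ 3 * (1 + 3 / ((p : ℕ) : ℝ) + 1 / ((p : ℕ) : ℝ) ^ 2))
      (coprimeConst 1 ^ 2 * ∑' n : ℕ, squarefreeProd mainWeight n / n) := by
  have h := ((hasProd_coprimeConst 1).mul (hasProd_coprimeConst 1)).mul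
    (hasProd_squarefreeProd mainWeight
      (summable_abs_squarefreeProd_div _ fun p hp => abs_mainWeight_le hp))
  rw [← sq] at h
  convert h using 2 with p
  have hp : ¬ (p : ℕ) ∣ 1 := p.2.one_lt.ne' ∘ Nat.dvd_one.1
  have h0 := (one_sub_inv_sq_pos p.2).ne'
  have hcw : 1 + coprimeWeight 1 p / ((p : ℕ) : ℝ) = 1 - 1 / ((p : ℕ) : ℝ) ^ 2 := by
    simp only [coprimeWeight, hp, if_false]
    ring
  rw [hcw]
  have h1 : (1 - 1 / ((p : ℕ) : ℝ) ^ 2) ^ 2 * (1 + mainWeight p) = (1 - 1 / ((p : ℕ) : ℝ)) ^ 3 := by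
    rw [mainWeight, add_sub_cancel, mul_div_cancel₀ _ (pow_ne_zero 2 h0)]
  -- With q = 1/p: (1-q²)²(1-q) + q(1-q)³ = (1-q)³((1+q)² + q).
  linear_combination (-1 / ((p : ℕ) : ℝ)) * h1

/-! ### Logarithmic mean values -/

lemma sum_Icc_sum_divisors_div (w : ℕ → ℝ) (x : ℝ) :
    ∑ d ∈ Finset.Icc 1 ⌊x⌋₊, (∑ e ∈ d.divisors, w e) / d =
      ∑ e ∈ Finset.Icc 1 ⌊x⌋₊, w e / e * (harmonic ⌊x / e⌋₊ : ℝ) := by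
  have h : ∀ d ∈ Finset.Icc 1 ⌊x⌋₊, (∑ e ∈ d.divisors, w e) / d =
      ∑ e ∈ d.divisors, w e / e * (((d / e : ℕ) : ℝ))⁻¹ := by
    intro d hd
    rw [Finset.sum_div]
    refine Finset.sum_congr rfl fun e he => ?_
    have hmul : (d : ℝ) = e * (d / e : ℕ) := by
      exact_mod_cast (Nat.mul_div_cancel' (Nat.dvd_of_mem_divisors he)).symm
    conv_lhs => rw [hmul]
    rw [← div_div, div_eq_mul_inv]
  rw [Finset.sum_congr rfl h, sum_Icc_sum_divisors (fun e m => w e / e * ((m : ℝ))⁻¹)]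
  refine Finset.sum_congr rfl fun e _ => ?_
  rw [← Finset.mul_sum, Nat.floor_div_natCast, harmonic_eq_sum_Icc]
  push_cast
  rfl

open Filter Topology in
lemma tendsto_harmonic_floor_div_log {e : ℕ} (he : 0 < e) :
    Tendsto (fun x : ℝ => (harmonic ⌊x / e⌋₊ : ℝ) / Real.log x) atTop (𝓝 1) := by
  have he' : (0 : ℝ) < e := by exact_mod_cast he
  have he1 : (1 : ℝ) ≤ e := by exact_mod_cast he
  have hlow : Tendsto (fun x : ℝ => 1 - Real.log e / Real.log x) atTop (𝓝 1) := by
    simpa using tendsto_const_nhds.sub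
      (Real.tendsto_log_atTop.const_div_atTop (Real.log e))
  have hup : Tendsto (fun x : ℝ => 1 / Real.log x + 1) atTop (𝓝 1) := by
    simpa using (Real.tendsto_log_atTop.const_div_atTop (1 : ℝ)).add_const 1
  refine tendsto_of_tendsto_of_tendsto_of_le_of_le' hlow hup ?_ ?_
  · filter_upwards [eventually_gt_atTop 1] with x hx
    have hlog := Real.log_pos hx
    rw [one_sub_div hlog.ne']
    gcongr
    rw [← Real.log_div (by positivity) he'.ne']
    exact log_le_harmonic_floor _ (by positivity)
  · filter_upwards [eventually_gt_atTop 1, eventually_ge_atTop (e : ℝ)] with x hx hxe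
    have hlog := Real.log_pos hx
    rw [div_add_one hlog.ne']
    gcongr
    refine (harmonic_floor_le_one_add_log _ ((one_le_div he').2 hxe)).trans ?_
    gcongr
    exact div_le_self (by linarith) he1

/-- Uniformity in e supplies the majorant for dominated convergence; x ≥ exp 1 lets log x absorb the
1 in 1 + log x. -/
lemma harmonic_floor_div_le {x : ℝ} (hx : Real.exp 1 ≤ x) (e : ℕ) :
    (harmonic ⌊x / e⌋₊ : ℝ) ≤ 2 * Real.log x := by
  have hx0 : 0 < x := (Real.exp_pos 1).trans_le hx
  have hlog : 1 ≤ Real.log x := (Real.le_log_iff_exp_le hx0).2 hx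
  rcases lt_or_ge (x / e) 1 with h | h
  · rw [Nat.floor_eq_zero.2 h]
    simp
    linarith
  · have he : (1 : ℝ) ≤ e := by
      rcases Nat.eq_zero_or_pos e with rfl | he
      · norm_num at h
      · exact_mod_cast he
    refine (harmonic_floor_le_one_add_log _ h).trans ?_
    have : Real.log (x / e) ≤ Real.log x :=
      Real.log_le_log (by linarith) (div_le_self hx0.le he)
    linarith

open Filter Topology in
/-- The logarithmic mean value of `1 * w`. -/
lemma tendsto_sum_sum_divisors_div_log {w : ℕ → ℝ} (hw : Summable fun n => |w n / n|) :
    Tendsto (fun x : ℝ =>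
      (∑ d ∈ Finset.Icc 1 ⌊x⌋₊, (∑ e ∈ d.divisors, w e) / d) / Real.log x) atTop
      (𝓝 (∑' n, w n / n)) := by
  have hEq : ∀ x : ℝ, (∑ d ∈ Finset.Icc 1 ⌊x⌋₊, (∑ e ∈ d.divisors, w e) / d) / Real.log x =
      ∑' e : ℕ, w e / e * ((harmonic ⌊x / e⌋₊ : ℝ) / Real.log x) := by
    intro x
    rw [sum_Icc_sum_divisors_div, Finset.sum_div,
      tsum_eq_sum (s := Finset.Icc 1 ⌊x⌋₊)]
    · exact Finset.sum_congr rfl fun e _ => mul_div_assoc _ _ _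
    · intro e he
      rcases Nat.eq_zero_or_pos e with rfl | he0
      · simp
      have : ⌊x⌋₊ < e := by
        by_contra h
        exact he (Finset.mem_Icc.2 ⟨he0, not_lt.1 h⟩)
      rw [Nat.floor_div_natCast, Nat.div_eq_of_lt this]
      simp
  simp_rw [hEq]
  refine tendsto_tsum_of_dominated_convergence (hw.mul_right 2) (fun e => ?_) ?_
  · rcases Nat.eq_zero_or_pos e with rfl | he
    · simp
    · simpa using (tendsto_harmonic_floor_div_log he).const_mul (w e / e)
  · filter_upwards [eventually_ge_atTop (Real.exp 1)] with x hx e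
    have hlog : 1 ≤ Real.log x := (Real.le_log_iff_exp_le ((Real.exp_pos 1).trans_le hx)).2 hx
    have hh : (0 : ℝ) ≤ harmonic ⌊x / e⌋₊ := by
      rw [harmonic_eq_sum_Icc]
      push_cast
      positivity
    rw [norm_mul, Real.norm_eq_abs, Real.norm_eq_abs,
      abs_of_nonneg (div_nonneg hh (by linarith))]
    gcongr
    rw [div_le_iff₀ (by linarith)]
    exact harmonic_floor_div_le hx e

/-! ### Summing the errors -/

lemma sum_Icc_one_div_sqrt_le (N : ℕ) :
    ∑ d ∈ Finset.Icc 1 N, 1 / √(d : ℝ) ≤ 2 * √N := by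
  induction N with
  | zero => simp
  | succ n ih =>
    rw [Finset.sum_Icc_succ_top (by omega)]
    push_cast
    have hs : 0 < √((n : ℝ) + 1) := Real.sqrt_pos.2 (by positivity)
    have h1 : √((n : ℝ) + 1) ^ 2 = n + 1 := Real.sq_sqrt (by positivity)
    have h2 : √(n : ℝ) ^ 2 = n := Real.sq_sqrt (by positivity)
    -- Telescoping bound: with s = √(n+1), t = √n and s² - t² = 1, it amounts to (s - t)² ≥ 0.
    have h3 : 1 / √((n : ℝ) + 1) ≤ 2 * √((n : ℝ) + 1) - 2 * √n := by
      rw [div_le_iff₀ hs]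
      nlinarith [sq_nonneg (√((n : ℝ) + 1) - √n)]
    linarith

lemma sum_Icc_sqrt_div_le {x : ℝ} (hx : 0 ≤ x) :
    ∑ d ∈ Finset.Icc 1 ⌊x⌋₊, √(x / d) ≤ 2 * x := by
  have h : ∀ d ∈ Finset.Icc 1 ⌊x⌋₊, √(x / d) = √x * (1 / √(d : ℝ)) := fun d _ => by
    rw [Real.sqrt_div hx, div_eq_mul_one_div]
  rw [Finset.sum_congr rfl h, ← Finset.mul_sum]
  calc √x * ∑ d ∈ Finset.Icc 1 ⌊x⌋₊, 1 / √(d : ℝ) ≤ √x * (2 * √x) := by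
        gcongr
        refine (sum_Icc_one_div_sqrt_le _).trans ?_
        gcongr
        exact Nat.floor_le hx
    _ = 2 * x := by linear_combination 2 * Real.mul_self_sqrt hx

lemma abs_sum_totientRatio_sub_le {d : ℕ} (hd : d ≠ 0) {x : ℝ} (hx : 0 ≤ x) :
    |∑ m ∈ Finset.Icc 1 (⌊x⌋₊ / d), totientRatio (d * m) -
      totientRatio d * coprimeConst d * (x / d)| ≤ sqrtErrorConst * √(x / d) := by
  have h : ∑ m ∈ Finset.Icc 1 (⌊x⌋₊ / d), totientRatio (d * m) = totientRatio d *
      ∑ m ∈ Finset.Icc 1 ⌊x / d⌋₊, ∑ e ∈ m.divisors, squarefreeProd (coprimeWeight d) e := by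
    rw [Finset.mul_sum, Nat.floor_div_natCast]
    exact Finset.sum_congr rfl fun m hm => totientRatio_mul hd (by simp at hm; omega)
  rw [h, mul_assoc, ← mul_sub, abs_mul, abs_of_nonneg (totientRatio_nonneg d),
    mul_comm (coprimeConst d)]
  exact (mul_le_of_le_one_left (abs_nonneg _) (totientRatio_le_one d)).trans
    (abs_sum_sum_divisors_sub_le (abs_squarefreeProd_coprimeWeight_le d) (by positivity))

lemma abs_sq_sub_sq_le {a b c s t : ℝ} (hc : 0 ≤ c) (hst : s ≤ t) (hab : |a - b| ≤ c * s)
    (hb : |b| ≤ c * t) : |a ^ 2 - b ^ 2| ≤ 3 * c ^ 2 * (s * t) := by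
  have h1 : |a + b| ≤ 3 * (c * t) := by
    have h2 := abs_add_le (a - b) (2 * b)
    rw [show a - b + 2 * b = a + b by ring, abs_mul, abs_two] at h2
    nlinarith [mul_le_mul_of_nonneg_left hst hc]
  rw [show a ^ 2 - b ^ 2 = (a - b) * (a + b) by ring, abs_mul]
  calc |a - b| * |a + b| ≤ (c * s) * (3 * (c * t)) :=
        mul_le_mul hab h1 (abs_nonneg _) ((abs_nonneg _).trans hab)
    _ = _ := by ring

lemma sqrtErrorConst_nonneg : 0 ≤ sqrtErrorConst := tsum_nonneg fun _ => by positivity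

/-- The sum of `totientLcm` up to an error `O(x ^ 2)`. -/
lemma abs_sum_totientLcm_sub_le {x : ℝ} (hx : 0 ≤ x) :
    |∑ a ∈ Finset.Icc 1 ⌊x⌋₊, ∑ b ∈ Finset.Icc 1 ⌊x⌋₊, totientLcm a b -
      x ^ 2 * (coprimeConst 1 ^ 2 * ∑ d ∈ Finset.Icc 1 ⌊x⌋₊,
        (∑ e ∈ d.divisors, squarefreeProd mainWeight e) / d)| ≤
      6 * sqrtErrorConst ^ 2 * x ^ 2 := by
  rw [sum_totientLcm, Finset.mul_sum, Finset.mul_sum, ← Finset.sum_sub_distrib]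
  calc _ ≤ ∑ d ∈ Finset.Icc 1 ⌊x⌋₊, 3 * sqrtErrorConst ^ 2 * x * √(x / d) := by
        refine (Finset.abs_sum_le_sum_abs _ _).trans (Finset.sum_le_sum fun d hd => ?_)
        rw [Finset.mem_Icc] at hd
        have hd0 : d ≠ 0 := by omega
        have hd1 : (1 : ℝ) ≤ d := by exact_mod_cast hd.1
        have hdx : (d : ℝ) ≤ x := (Nat.le_floor_iff hx).1 hd.2
        have hy : 1 ≤ x / d := (one_le_div (by linarith)).2 hdx
        -- Since φ(d) = d r(d), the powers of d combine to 1/d.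
        have hmain : x ^ 2 * (coprimeConst 1 ^ 2 *
            ((∑ e ∈ d.divisors, squarefreeProd mainWeight e) / d)) =
            d.totient * (totientRatio d * coprimeConst d * (x / d)) ^ 2 := by
          rw [totient_eq_mul_totientRatio, ← mul_div_assoc,
            ← totientRatio_pow_mul_coprimeConst hd0]
          field_simp
        have hsq : √(x / d) ≤ x / d := by
          rw [Real.sqrt_le_left (by linarith)]
          nlinarith
        have hB : |totientRatio d * coprimeConst d * (x / d)| ≤ sqrtErrorConst * (x / d) := by
          rw [abs_mul, abs_mul, abs_of_nonneg (totientRatio_nonneg d),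
            abs_of_nonneg (by linarith : 0 ≤ x / d)]
          gcongr
          exact (mul_le_of_le_one_left (abs_nonneg _) (totientRatio_le_one d)).trans
            (abs_coprimeConst_le d)
        rw [hmain, ← mul_sub, abs_mul, Nat.abs_cast]
        -- The bound φ(d) ≤ d cancels the denominator of x/d, leaving x √(x/d), whose sum over d is
        -- O(x²).
        calc (d.totient : ℝ) * _ ≤ d * (3 * sqrtErrorConst ^ 2 * (√(x / d) * (x / d))) := by
              gcongr
              · exact Nat.totient_le d
              · exact abs_sq_sub_sq_le sqrtErrorConst_nonneg hsq
                  (abs_sum_totientRatio_sub_le hd0 hx) hB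
          _ = 3 * sqrtErrorConst ^ 2 * x * √(x / d) := by
              field_simp
    _ ≤ 3 * sqrtErrorConst ^ 2 * x * (2 * x) := by
        rw [← Finset.mul_sum]
        gcongr
        exact sum_Icc_sqrt_div_le hx
    _ = _ := by ring

theorem mainTheorem11 :
    Multipliable (fun p : Nat.Primes =>
      (1 - 1 / ((p : ℕ) : ℝ)) ^ 3 * (1 + 3 / ((p : ℕ) : ℝ) + 1 / ((p : ℕ) : ℝ) ^ 2)) ∧
    Filter.Tendsto
      (fun x : ℝ => 1 / (x ^ 2 * Real.log x) *
        ∑ n₁ ∈ Finset.Icc 1 ⌊x⌋₊, ∑ n₂ ∈ Finset.Icc 1 ⌊x⌋₊, totientLcm n₁ n₂)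
      Filter.atTop
      (nhds (∏' p : Nat.Primes,
        (1 - 1 / ((p : ℕ) : ℝ)) ^ 3 *
          (1 + 3 / ((p : ℕ) : ℝ) + 1 / ((p : ℕ) : ℝ) ^ 2))) := by
  refine ⟨hasProd_leadingConst.multipliable, ?_⟩
  rw [hasProd_leadingConst.tprod_eq]
  have hmain := (tendsto_sum_sum_divisors_div_log
    (summable_abs_squarefreeProd_div _ fun p hp => abs_mainWeight_le hp)).const_mul
    (coprimeConst 1 ^ 2)
  -- Division by x² log x turns the O(x²) error into O(1/log x).
  refine tendsto_of_tendsto_of_dist hmain ?_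
  refine squeeze_zero' (Filter.Eventually.of_forall fun _ => dist_nonneg) ?_
    (Real.tendsto_log_atTop.const_div_atTop (6 * sqrtErrorConst ^ 2))
  filter_upwards [Filter.eventually_gt_atTop 1] with x hx
  have hlog := Real.log_pos hx
  have hx0 : 0 < x := by linarith
  have h := abs_sum_totientLcm_sub_le hx0.le
  rw [dist_comm, Real.dist_eq]
  set S := ∑ n₁ ∈ Finset.Icc 1 ⌊x⌋₊, ∑ n₂ ∈ Finset.Icc 1 ⌊x⌋₊, totientLcm n₁ n₂
  set T := ∑ d ∈ Finset.Icc 1 ⌊x⌋₊, (∑ e ∈ d.divisors, squarefreeProd mainWeight e) / d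
  rw [show 1 / (x ^ 2 * Real.log x) * S - coprimeConst 1 ^ 2 * (T / Real.log x) =
      (S - x ^ 2 * (coprimeConst 1 ^ 2 * T)) / (x ^ 2 * Real.log x) by field_simp,
    abs_div, abs_of_pos (by positivity : 0 < x ^ 2 * Real.log x), div_le_iff₀ (by positivity)]
  refine h.trans_eq ?_
  field_simp
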